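/- Let $\mathcal F_n^2$ ($n\ge 0$) be the set of Dyck paths of semilength $n$ (with up steps $U=(1,1)$ and down steps $D=(1,-1)$) that contain neither of the factors $DUU$ and $DDD$ of consecutive steps, and let $\mathbb F_n^2$ be this set ordered by the Stanley order: $P\le Q$ if and only if the path $P$ lies weakly below the path $Q$. For $P\le Q$ in $\mathbb F_n^2$, the interval $[P,Q]=\{R\in\mathbb F_n^2 : P\le R\le Q\}$ is linear if its elements are pairwise comparable, and its height is the length of a maximal chain from $P$ to $Q$ (a chain $R_0<R_1<\dots<R_m$ has length $m$). Let $L_2(x,y)$ be the formal power series in which, for all $n,k\ge 0$, the coefficient of $x^ny^k$ is the number of linear intervals of height $k$ in $\mathbb F_n^2$. Then $$L_2(x,y)=\frac{x^{4}y^{4}+x^{4}y^{3}+1}{1-x-x^2}+\frac{x^{2}y\,(x^{2}-1)(x^{3}y^{2}-1)}{(xy-1)(x^{2}+x-1)^{2}(x^{2}y-1)}.$$ -/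

import Mathlib

/-- The Dyck paths of semilength `n` that avoid the patterns (consecutive factors) `DUU` and
`D^(p+1)`. A `DyckWord` is a list of steps `U`, `D` with as many `U`s as `D`s, each of whose
prefixes has at least as many `U`s as `D`s. -/
@[ext]
structure FibDyck (p n : ℕ) where
  /-- The underlying Dyck path. -/
  path : DyckWord
  semilength_eq : path.semilength = n
  avoids_DUU : ¬ [DyckStep.D, DyckStep.U, DyckStep.U] <:+: path.toList
  avoids_D_pow : ¬ List.replicate (p + 1) DyckStep.D <:+: path.toList

namespace FibDyck

variable {p n : ℕ}

/-- The ordinate reached by the path `P` after its first `i` steps. -/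
def ordinate (P : FibDyck p n) (i : ℕ) : ℤ :=
  ((P.path.toList.take i).count DyckStep.U : ℤ) - ((P.path.toList.take i).count DyckStep.D : ℤ)

theorem length_toList (P : FibDyck p n) : P.path.toList.length = 2 * n := by
  rw [← P.path.two_mul_semilength_eq_length, P.semilength_eq]

theorem eq_of_ordinate_eq {P Q : FibDyck p n} (h : ∀ i, P.ordinate i = Q.ordinate i) :
    P = Q := by
  have hlen : P.path.toList.length = Q.path.toList.length := by
    rw [P.length_toList, Q.length_toList]
  have hlist : P.path.toList = Q.path.toList := by
    refine List.ext_getElem hlen fun i hP hQ => ?_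
    have h0 := h i
    have h1 := h (i + 1)
    simp only [ordinate, List.take_add_one, List.getElem?_eq_getElem hP,
      List.getElem?_eq_getElem hQ, Option.toList_some, List.count_append] at h0 h1
    rcases (P.path.toList[i]).dichotomy with a | a <;>
      rcases (Q.path.toList[i]).dichotomy with b | b <;>
      simp [a, b] at h1 ⊢ <;> omega
  exact FibDyck.ext (DyckWord.ext hlist)

/-- The Stanley order: `P ≤ Q` when the path `P` is weakly below the path `Q`. -/
instance : PartialOrder (FibDyck p n) where
  le P Q := ∀ i, P.ordinate i ≤ Q.ordinate i
  le_refl _ _ := le_rfl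
  le_trans _ _ _ h h' i := (h i).trans (h' i)
  le_antisymm _ _ h h' := eq_of_ordinate_eq fun i => le_antisymm (h i) (h' i)

instance : Finite (FibDyck p n) :=
  Finite.of_injective
    (fun P : FibDyck p n => (⟨P.path, P.semilength_eq⟩ : {w : DyckWord // w.semilength = n}))
    fun _ _ h => FibDyck.ext (congrArg Subtype.val h)

end FibDyck

/-- The interval `[P, Q]`, `P ≤ Q`, is linear: its elements are pairwise comparable. -/
def IsLinearInterval {α : Type*} [PartialOrder α] (I : NonemptyInterval α) : Prop :=
  ∀ R ∈ Set.Icc I.fst I.snd, ∀ S ∈ Set.Icc I.fst I.snd, R ≤ S ∨ S ≤ R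

/-- The interval `[P, Q]` has height `k`: the supremum of the lengths of its chains is `k`
(a chain `R₀ < R₁ < ⋯ < Rₘ` has length `m`). -/
def HasIntervalHeight {α : Type*} [PartialOrder α] (I : NonemptyInterval α) (k : ℕ) : Prop :=
  Order.krullDim (Set.Icc I.fst I.snd) = (k : WithBot ℕ∞)

/-- The number of linear intervals of height `k` in the poset of the Dyck paths of semilength `n`
that avoid `DUU` and `D^(p+1)`. -/
noncomputable def numLinearIntervals (p n k : ℕ) : ℕ :=
  Nat.card {I : NonemptyInterval (FibDyck p n) // IsLinearInterval I ∧ HasIntervalHeight I k}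

/-- The generating function of linear intervals, a formal power series in `x = X 0` and
`y = X 1`: the coefficient of `x ^ n * y ^ k` is the number of linear intervals of height `k` in
the poset of paths of semilength `n`. -/
noncomputable def linearIntervalSeries (p : ℕ) : MvPowerSeries (Fin 2) ℚ :=
  fun m => (numLinearIntervals p (m 0) (m 1) : ℚ)

/-! Read a path backwards and record the number of down steps met before each up step. Avoiding
`DDD` and `DUU` makes these numbers the partial sums of a composition of `n` into parts 1 and 2,
constant after reaching `n`, and the Stanley order becomes the pointwise order
(`FibDyck.fibSeqIso`). In a finite poset a linear interval of height `k` is a chain of `k + 1`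
elements, so pairs `P`, `Q` of sequences bounding such chains are to be counted.

If the first parts of `P` and `Q` agree, deleting them leaves the same problem for `n - 1` or `n -
2`. Otherwise `P` starts with 1 and `Q` with 2. The least element of the interval starting with 2
and the greatest one starting with 1 must then be comparable, which is so restrictive that only two
infinite families and two sporadic pairs with `n = 4` remain (`FibSeq.irreduciblePairs_eq`). In a
family `P` has a forced initial segment and a free tail, so Fibonacci numbers count it. Writing `L`,
`A`, `B`, `F` for the series of all chains, of the two families and of compositions, this gives `(1
- x - x²) L = 1 + A + B + x⁴y³ + x⁴y⁴`, `(1 - xy) A = x²y (1 + xF)`, `(1 - x²y) B = x⁴y² (1 + xF)`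
and `(1 - x - x²) F = 1`; eliminating `A`, `B`, `F` yields the formula. -/

/-! ### Intervals that are chains. -/

/-- The interval `[a, b]` is a chain of length `k`: it is the range of a strictly increasing
sequence of `k + 1` elements. -/
def IsChainInterval {α : Type*} [PartialOrder α] (a b : α) (k : ℕ) : Prop :=
  ∃ c : Fin (k + 1) → α, StrictMono c ∧ Set.range c = Set.Icc a b

theorem Order.krullDim_fin_succ (k : ℕ) : Order.krullDim (Fin (k + 1)) = (k : WithBot ℕ∞) := by
  apply le_antisymm
  · refine iSup_le fun p => ?_
    have := Fintype.card_le_of_injective p.toFun p.strictMono.injective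
    rw [Fintype.card_fin, Fintype.card_fin] at this
    exact_mod_cast Nat.le_of_succ_le_succ this
  · exact LTSeries.length_le_krullDim
      (⟨k, id, fun i => Fin.castSucc_lt_succ⟩ : LTSeries (Fin (k + 1)))

namespace IsChainInterval

variable {α β : Type*} [PartialOrder α] [PartialOrder β] {a b : α} {k : ℕ}

theorem le (h : IsChainInterval a b k) : a ≤ b := by
  obtain ⟨c, -, hr⟩ := h
  have : c 0 ∈ Set.Icc a b := hr ▸ Set.mem_range_self 0
  exact this.1.trans this.2

theorem comparable (h : IsChainInterval a b k) {x y : α} (hx : x ∈ Set.Icc a b)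
    (hy : y ∈ Set.Icc a b) : x ≤ y ∨ y ≤ x := by
  obtain ⟨c, hc, hr⟩ := h
  rw [← hr] at hx hy
  obtain ⟨i, rfl⟩ := hx
  obtain ⟨j, rfl⟩ := hy
  exact (le_total i j).imp (fun h => hc.monotone h) (fun h => hc.monotone h)

theorem krullDim_eq (h : IsChainInterval a b k) :
    Order.krullDim (Set.Icc a b) = (k : WithBot ℕ∞) := by
  obtain ⟨c, hc, hr⟩ := h
  let d : Fin (k + 1) ↪o α := OrderEmbedding.ofStrictMono c hc
  let e : Fin (k + 1) ≃o Set.Icc a b :=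
    (OrderEmbedding.orderIso (f := d)).trans (OrderIso.setCongr _ _ hr)
  rw [← Order.krullDim_eq_of_orderIso e, Order.krullDim_fin_succ]

theorem length_unique {l : ℕ} (h : IsChainInterval a b k) (h' : IsChainInterval a b l) :
    k = l := by
  have := h.krullDim_eq.symm.trans h'.krullDim_eq
  exact_mod_cast this

theorem zero_iff : IsChainInterval a b 0 ↔ a = b := by
  constructor
  · intro h
    have hle := h.le
    obtain ⟨c, hc, hr⟩ := h
    have ha : a ∈ Set.range c := hr ▸ Set.left_mem_Icc.2 hle
    have hb : b ∈ Set.range c := hr ▸ Set.right_mem_Icc.2 hle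
    obtain ⟨i, rfl⟩ := ha
    obtain ⟨j, rfl⟩ := hb
    rw [Fin.fin_one_eq_zero i, Fin.fin_one_eq_zero j]
  · rintro rfl
    refine ⟨fun _ => a, fun i j hij => absurd hij (by
      rw [Fin.fin_one_eq_zero i, Fin.fin_one_eq_zero j]; exact lt_irrefl _), ?_⟩
    simp

/-- By `hx`, passing from `a'` down to `a` adds only the element `a` to the interval. -/
theorem extend {a' : α} (h : IsChainInterval a' b k) (ha : a < a')
    (hx : ∀ x ∈ Set.Icc a b, x = a ∨ a' ≤ x) : IsChainInterval a b (k + 1) := by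
  have hab := h.le
  obtain ⟨c, hc, hr⟩ := h
  have hmem : ∀ i, c i ∈ Set.Icc a' b := fun i => hr ▸ Set.mem_range_self i
  refine ⟨Fin.cons a c, ?_, ?_⟩
  · intro i j hij
    induction i using Fin.cases with
    | zero =>
      induction j using Fin.cases with
      | zero => exact absurd hij (lt_irrefl _)
      | succ j => simpa using ha.trans_le (hmem j).1
    | succ i =>
      induction j using Fin.cases with
      | zero => exact absurd hij (Fin.not_lt_zero _)
      | succ j => simpa using hc (Fin.succ_lt_succ_iff.1 hij)
  · rw [Fin.range_cons, hr]
    ext x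
    constructor
    · rintro (rfl | h)
      · exact ⟨le_rfl, ha.le.trans hab⟩
      · exact ⟨ha.le.trans h.1, h.2⟩
    · intro h
      exact (hx x h).imp id fun h' => ⟨h', h.2⟩

theorem image_iff (e : α ↪o β) (he : e '' Set.Icc a b = Set.Icc (e a) (e b)) :
    IsChainInterval (e a) (e b) k ↔ IsChainInterval a b k := by
  constructor
  · rintro ⟨c, hc, hr⟩
    have hmem : ∀ i, ∃ x ∈ Set.Icc a b, e x = c i := fun i => by
      have : c i ∈ e '' Set.Icc a b := by rw [he, ← hr]; exact Set.mem_range_self i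
      exact this
    choose d hd hed using hmem
    refine ⟨d, fun i j hij => ?_, ?_⟩
    · rw [← e.lt_iff_lt, hed, hed]
      exact hc hij
    · apply Set.Subset.antisymm
      · rintro _ ⟨i, rfl⟩
        exact hd i
      · intro x hx
        have : e x ∈ Set.range c := by rw [hr, ← he]; exact Set.mem_image_of_mem _ hx
        obtain ⟨i, hi⟩ := this
        exact ⟨i, e.injective ((hed i).trans hi)⟩
  · rintro ⟨c, hc, hr⟩
    refine ⟨e ∘ c, e.strictMono.comp hc, ?_⟩
    rw [Set.range_comp, hr, he]

theorem orderIso_iff (e : α ≃o β) :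
    IsChainInterval (e a) (e b) k ↔ IsChainInterval a b k :=
  image_iff e.toOrderEmbedding (e.image_Icc a b)

theorem subtype_iff {s : Set α} (hs : s.OrdConnected) {a b : s} :
    IsChainInterval (a : α) (b : α) k ↔ IsChainInterval a b k := by
  refine image_iff (OrderEmbedding.subtype (· ∈ s)) ?_
  ext x
  constructor
  · rintro ⟨y, hy, rfl⟩
    exact ⟨hy.1, hy.2⟩
  · intro hx
    exact ⟨⟨x, hs.out a.2 b.2 hx⟩, ⟨hx.1, hx.2⟩, rfl⟩

end IsChainInterval

theorem isLinearInterval_and_hasIntervalHeight_iff {α : Type*} [PartialOrder α] [Finite α]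
    (I : NonemptyInterval α) (k : ℕ) :
    IsLinearInterval I ∧ HasIntervalHeight I k ↔ IsChainInterval I.fst I.snd k := by
  classical
  constructor
  · rintro ⟨hl, hh⟩
    have : Fintype (Set.Icc I.fst I.snd) := Fintype.ofFinite _
    let inst : LinearOrder (Set.Icc I.fst I.snd) :=
      { (inferInstance : PartialOrder (Set.Icc I.fst I.snd)) with
        le_total := fun x y => hl x x.2 y y.2
        toDecidableLE := Classical.decRel _ }
    have hne : Nonempty (Set.Icc I.fst I.snd) := ⟨⟨I.fst, le_rfl, I.fst_le_snd⟩⟩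
    obtain ⟨m, hm⟩ : ∃ m, Fintype.card (Set.Icc I.fst I.snd) = m + 1 :=
      Nat.exists_eq_succ_of_ne_zero Fintype.card_ne_zero
    let e := Fintype.orderIsoFinOfCardEq (Set.Icc I.fst I.snd) hm
    have hc : IsChainInterval I.fst I.snd m := by
      refine ⟨fun i => (e i : α), fun i j hij => ?_, ?_⟩
      · exact e.strictMono hij
      · ext x
        constructor
        · rintro ⟨i, rfl⟩
          exact (e i).2
        · intro hx
          exact ⟨e.symm ⟨x, hx⟩, by simp⟩
    have : m = k := by
      have := hc.krullDim_eq.symm.trans hh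
      exact_mod_cast this
    exact this ▸ hc
  · intro h
    exact ⟨fun R hR S hS => h.comparable hR hS, h.krullDim_eq⟩

theorem card_linear_intervals_eq {α β : Type*} [PartialOrder α] [Finite α] [PartialOrder β]
    (e : α ≃o β) (k : ℕ) :
    Nat.card {I : NonemptyInterval α // IsLinearInterval I ∧ HasIntervalHeight I k} =
      {p : β × β | IsChainInterval p.1 p.2 k}.ncard := by
  rw [← Nat.card_coe_set_eq]
  refine Nat.card_congr
    { toFun := fun I => ⟨(e I.1.fst, e I.1.snd),
        (IsChainInterval.orderIso_iff e).2
          ((isLinearInterval_and_hasIntervalHeight_iff I.1 k).1 I.2)⟩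
      invFun := fun p => ⟨⟨(e.symm p.1.1, e.symm p.1.2), e.symm.monotone p.2.le⟩,
        (isLinearInterval_and_hasIntervalHeight_iff _ k).2
          ((IsChainInterval.orderIso_iff e.symm).2 p.2)⟩
      left_inv := fun I => by
        ext <;> simp
      right_inv := fun p => by
        ext <;> simp }

/-! ### The poset of compositions into parts 1 and 2. -/

/-- `f` is the sequence of partial sums of a composition of `n` into parts `1` and `2`, continued
by the value `n`. -/
def IsFibSeq (n : ℕ) (f : ℕ → ℕ) : Prop :=
  f 0 = 0 ∧ ∀ j, min n (f j + 1) ≤ f (j + 1) ∧ f (j + 1) ≤ min n (f j + 2)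

/-- The poset, for the pointwise order, of the sequences of partial sums of compositions of `n`
into parts `1` and `2`. -/
abbrev FibSeq (n : ℕ) : Type := {f : ℕ → ℕ // IsFibSeq n f}

namespace IsFibSeq

variable {n : ℕ} {f : ℕ → ℕ}

theorem le (h : IsFibSeq n f) (j : ℕ) : f j ≤ n := by
  cases j with
  | zero => rw [h.1]; exact Nat.zero_le _
  | succ j => exact (h.2 j).2.trans (min_le_left _ _)

theorem growth (h : IsFibSeq n f) (a b : ℕ) :
    min n (f a + b) ≤ f (a + b) ∧ f (a + b) ≤ f a + 2 * b := by
  induction b with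
  | zero => simp
  | succ b ih =>
    have := h.2 (a + b)
    rw [show a + (b + 1) = a + b + 1 from rfl]
    omega

theorem growth_of_le (h : IsFibSeq n f) {a b : ℕ} (hab : a ≤ b) :
    min n (f a + (b - a)) ≤ f b ∧ f b ≤ f a + 2 * (b - a) := by
  have := h.growth a (b - a)
  rwa [Nat.add_sub_cancel' hab] at this

theorem bounds (h : IsFibSeq n f) (j : ℕ) : min n j ≤ f j ∧ f j ≤ 2 * j := by
  have := h.growth_of_le (Nat.zero_le j)
  rw [h.1] at this
  omega

end IsFibSeq

/-! ### Classification of the chains whose ends differ at the first part. -/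

namespace FibSeq

variable {n k : ℕ}

/-- Along the chain a part 2 moves left through the initial ones. Since `P` grows by the minimal
step up to `k`, an element that exceeds `P` at some index keeps exceeding it up to `k`. -/
theorem isChainInterval_of_ones {P Q : FibSeq n} (hP : ∀ j ≤ k, P.1 j = j)
    (hQ : ∀ j, Q.1 j = P.1 j + if 1 ≤ j ∧ j ≤ k then 1 else 0) : IsChainInterval P Q k := by
  have hkn : k ≠ 0 → k + 1 ≤ n := fun hk => by
    have h1 := hQ k
    rw [if_pos (by omega), hP k le_rfl] at h1
    exact h1 ▸ Q.2.le k
  have valid : ∀ i : Fin (k + 1),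
      IsFibSeq n fun j => P.1 j + if k - i < j ∧ j ≤ k then 1 else 0 := fun i => by
    refine ⟨by simp [P.2.1], fun j => ?_⟩
    have h1 := P.2.2 j
    have h2 := Q.2.2 j
    have h3 := hQ j
    have h4 := hQ (j + 1)
    have h5 := hP j
    have h6 := hP (j + 1)
    have h7 := i.2
    dsimp only
    split_ifs at * <;> omega
  refine ⟨fun i => ⟨_, valid i⟩, fun i i' hii => ?_, ?_⟩
  · have hlt : (i : ℕ) < i' := hii
    have h7 := i'.2
    refine lt_of_le_of_ne (fun j => ?_) fun h => ?_
    · dsimp only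
      split_ifs <;> omega
    · have := congrFun (congrArg Subtype.val h) (k - i' + 1)
      dsimp only at this
      split_ifs at this <;> omega
  · ext R
    constructor
    · rintro ⟨i, rfl⟩
      refine ⟨fun j => ?_, fun j => ?_⟩
      · dsimp only
        omega
      · rw [hQ j]
        dsimp only
        split_ifs <;> omega
    · rintro ⟨hPR, hRQ⟩
      -- `R` is determined by the first index `t` at which it leaves `P`, with `t = k + 1` if `R =
      -- P`: it is `P` raised by one on `t, ..., k`.
      have hex : ∃ j, k < j ∨ P.1 j < R.1 j := ⟨k + 1, Or.inl (Nat.lt_succ_self k)⟩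
      classical
      set t := Nat.find hex with ht
      have hspec : k < t ∨ P.1 t < R.1 t := Nat.find_spec hex
      have hmin : ∀ j < t, ¬ (k < j ∨ P.1 j < R.1 j) := fun j hj => Nat.find_min hex hj
      have htk : t ≤ k + 1 := Nat.find_min' hex (Or.inl (Nat.lt_succ_self k))
      have ht0 : 0 < t := by
        rcases Nat.eq_zero_or_pos t with h | h
        · rw [h, R.2.1, P.2.1] at hspec
          omega
        · exact h
      refine ⟨⟨k + 1 - t, by omega⟩, Subtype.ext (funext fun j => ?_)⟩
      have h1 := hPR j
      have h2 := hRQ j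
      have h3 := hQ j
      change P.1 j ≤ R.1 j at h1
      change R.1 j ≤ Q.1 j at h2
      dsimp only
      by_cases hjt : j < t
      · have := hmin j hjt
        rw [if_neg (by omega)]
        omega
      · by_cases hjk : j ≤ k
        · have h4 := (R.2.growth_of_le (not_lt.1 hjt)).1
          have h5 := hP j hjk
          have h6 := hP t (by omega)
          rw [if_pos (by omega)] at h3 ⊢
          omega
        · rw [if_neg (by omega)] at h3 ⊢
          omega

/-- Along the chain the part 1 moves right through the twos. Since `P` grows by the maximal step
from 1 to `k`, an element that meets `P` at some index there cannot exceed it again. -/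
theorem isChainInterval_of_twos {P Q : FibSeq n} (hP : ∀ j, 1 ≤ j → j ≤ k → P.1 j = 2 * j - 1)
    (hQ : ∀ j, Q.1 j = P.1 j + if 1 ≤ j ∧ j ≤ k then 1 else 0) : IsChainInterval P Q k := by
  have hkn : k ≠ 0 → 2 * k ≤ n := fun hk => by
    have h1 := hQ k
    rw [if_pos (by omega), hP k (by omega) le_rfl] at h1
    have := Q.2.le k
    omega
  have valid : ∀ i : Fin (k + 1),
      IsFibSeq n fun j => P.1 j + if 1 ≤ j ∧ j ≤ i then 1 else 0 := fun i => by
    refine ⟨by simp [P.2.1], fun j => ?_⟩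
    have h0 := P.2.1
    have h1 := P.2.2 j
    have h2 := Q.2.2 j
    have h3 := hQ j
    have h4 := hQ (j + 1)
    have h5 := hP j
    have h6 := hP (j + 1)
    have h7 := i.2
    dsimp only
    rcases Nat.eq_zero_or_pos j with rfl | hj <;> split_ifs at * <;> omega
  refine ⟨fun i => ⟨_, valid i⟩, fun i i' hii => ?_, ?_⟩
  · have hlt : (i : ℕ) < i' := hii
    refine lt_of_le_of_ne (fun j => ?_) fun h => ?_
    · dsimp only
      split_ifs <;> omega
    · have := congrFun (congrArg Subtype.val h) i'
      dsimp only at this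
      split_ifs at this <;> omega
  · ext R
    constructor
    · rintro ⟨i, rfl⟩
      have h7 := i.2
      refine ⟨fun j => ?_, fun j => ?_⟩
      · dsimp only
        omega
      · rw [hQ j]
        dsimp only
        split_ifs <;> omega
    · rintro ⟨hPR, hRQ⟩
      -- `t` is the first positive index at which `R` meets `P`, or `k + 1`; `R` is `P` raised by
      -- one on `1, ..., t - 1`.
      have hex : ∃ j, k < j ∨ (1 ≤ j ∧ R.1 j = P.1 j) := ⟨k + 1, Or.inl (Nat.lt_succ_self k)⟩
      classical
      set t := Nat.find hex with ht
      have hspec : k < t ∨ (1 ≤ t ∧ R.1 t = P.1 t) := Nat.find_spec hex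
      have hmin : ∀ j < t, ¬ (k < j ∨ (1 ≤ j ∧ R.1 j = P.1 j)) :=
        fun j hj => Nat.find_min hex hj
      have htk : t ≤ k + 1 := Nat.find_min' hex (Or.inl (Nat.lt_succ_self k))
      refine ⟨⟨t - 1, by omega⟩, Subtype.ext (funext fun j => ?_)⟩
      have h1 := hPR j
      have h2 := hRQ j
      have h3 := hQ j
      change P.1 j ≤ R.1 j at h1
      change R.1 j ≤ Q.1 j at h2
      dsimp only
      by_cases hjt : j < t
      · have := hmin j hjt
        split_ifs at * <;> omega
      · by_cases hjk : j ≤ k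
        · have h4 := (R.2.growth_of_le (not_lt.1 hjt)).2
          have h5 := hP j
          have h6 := hP t
          rw [if_pos (by omega)] at h3
          rw [if_neg (by omega)]
          omega
        · rw [if_neg (by omega)] at h3 ⊢
          omega

/-- The pairs `1ᵏ 2 v`, `2 1ᵏ v` and the pairs `1ᵏ 1`, `2 1ᵏ⁻¹` of compositions, as sequences of
partial sums. -/
def onesPairs (n k : ℕ) : Set (FibSeq n × FibSeq n) :=
  {p | 1 ≤ k ∧ (∀ j ≤ k, p.1.1 j = j) ∧
    ∀ j, p.2.1 j = p.1.1 j + if 1 ≤ j ∧ j ≤ k then 1 else 0}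

/-- The pairs `1 2ᵏ v`, `2ᵏ 1 v` and the pairs `1 2ᵏ⁻¹ 1`, `2ᵏ` of compositions, with `2 ≤ k`, as
sequences of partial sums. -/
def twosPairs (n k : ℕ) : Set (FibSeq n × FibSeq n) :=
  {p | 2 ≤ k ∧ (∀ j, 1 ≤ j → j ≤ k → p.1.1 j = 2 * j - 1) ∧
    ∀ j, p.2.1 j = p.1.1 j + if 1 ≤ j ∧ j ≤ k then 1 else 0}

/-- The pair `1111`, `22` of compositions, as sequences of partial sums. -/
def longPair (n k : ℕ) : Set (FibSeq n × FibSeq n) :=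
  {p | n = 4 ∧ k = 4 ∧ (∀ j, p.1.1 j = min j 4) ∧ ∀ j, p.2.1 j = min (2 * j) 4}

/-- The pair `112`, `22` of compositions, as sequences of partial sums. -/
def shortPair (n k : ℕ) : Set (FibSeq n × FibSeq n) :=
  {p | n = 4 ∧ k = 3 ∧ (∀ j, p.1.1 j = if j ≤ 2 then j else 4) ∧ ∀ j, p.2.1 j = min (2 * j) 4}

/-- The pairs that bound a chain of length `k` and differ at the first part. -/
def irreduciblePairs (n k : ℕ) : Set (FibSeq n × FibSeq n) :=
  {p | p.1.1 1 = 1 ∧ p.2.1 1 = 2 ∧ IsChainInterval p.1 p.2 k}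

/-- The chain is `112 < 121 < 211 < 22`; its part above `121` belongs to the family of twos. -/
theorem isChainInterval_three {P Q : FibSeq 4} (hP : ∀ j, P.1 j = if j ≤ 2 then j else 4)
    (hQ : ∀ j, Q.1 j = min (2 * j) 4) : IsChainInterval P Q 3 := by
  have valid : IsFibSeq 4 fun j => min (2 * j - 1) 4 := by
    refine ⟨rfl, fun j => ?_⟩
    dsimp only
    rcases Nat.eq_zero_or_pos j with rfl | h
    · decide
    · omega
  refine IsChainInterval.extend (a' := ⟨_, valid⟩) (isChainInterval_of_twos (k := 2) ?_ ?_) ?_ ?_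
  · intro j h1 h2
    dsimp only
    omega
  · intro j
    rw [hQ j]
    dsimp only
    split_ifs <;> omega
  · refine lt_of_le_of_ne (fun j => ?_) fun h => ?_
    · rw [hP j]
      dsimp only
      split_ifs <;> omega
    · have := congrFun (congrArg Subtype.val h) 2
      rw [hP 2] at this
      simp at this
  · rintro R ⟨hR, -⟩
    by_cases h2 : R.1 2 ≤ 2
    · left
      refine Subtype.ext (funext fun j => ?_)
      have h3 := hR j
      change P.1 j ≤ R.1 j at h3
      have h4 := R.2.le j
      rw [hP j] at h3 ⊢
      split_ifs at * with h
      · have h5 := (R.2.growth_of_le h).1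
        omega
      · omega
    · right
      intro j
      have h5 := R.2.bounds j
      have h3 := hR j
      change P.1 j ≤ R.1 j at h3
      rw [hP j] at h3
      change min (2 * j - 1) 4 ≤ R.1 j
      by_cases hj : j = 2
      · subst hj
        omega
      · split_ifs at h3 <;> omega

/-- `1111` is added below the chain from `112` to `22`. -/
theorem isChainInterval_four {P Q : FibSeq 4} (hP : ∀ j, P.1 j = min j 4)
    (hQ : ∀ j, Q.1 j = min (2 * j) 4) : IsChainInterval P Q 4 := by
  have valid : IsFibSeq 4 fun j => if j ≤ 2 then j else 4 := by
    refine ⟨rfl, fun j => ?_⟩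
    dsimp only
    split_ifs <;> omega
  refine IsChainInterval.extend (a' := ⟨_, valid⟩) (isChainInterval_three (fun _ => rfl) hQ) ?_ ?_
  · refine lt_of_le_of_ne (fun j => ?_) fun h => ?_
    · rw [hP j]
      dsimp only
      split_ifs <;> omega
    · have := congrFun (congrArg Subtype.val h) 3
      rw [hP 3] at this
      simp at this
  · rintro R ⟨hR, -⟩
    by_cases h3 : R.1 3 ≤ 3
    · left
      refine Subtype.ext (funext fun j => ?_)
      have h4 := R.2.le j
      have h6 := R.2.bounds j
      rw [hP j]
      by_cases h : j ≤ 3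
      · have h5 := (R.2.growth_of_le h).1
        omega
      · omega
    · right
      intro j
      have h6 := R.2.bounds j
      change (if j ≤ 2 then j else 4) ≤ R.1 j
      by_cases hj : j = 3
      · subst hj
        simp
        omega
      · split_ifs <;> omega

theorem mem_of_isChainInterval {P Q : FibSeq n} (hP1 : P.1 1 = 1) (hQ1 : Q.1 1 = 2)
    (h : IsChainInterval P Q k) :
    (P, Q) ∈ (onesPairs n k ∪ twosPairs n k) ∪ (longPair n k ∪ shortPair n k) := by
  have hPQ : ∀ j, P.1 j ≤ Q.1 j := h.le
  have hn2 : 2 ≤ n := hQ1 ▸ Q.2.le 1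
  have hPb : ∀ j, 1 ≤ j → P.1 j ≤ 2 * j - 1 := fun j hj => by
    have := (P.2.growth_of_le hj).2
    omega
  have hQb : ∀ j, 1 ≤ j → min n (j + 1) ≤ Q.1 j := fun j hj => by
    have := (Q.2.growth_of_le hj).1
    omega
  -- The least element `X` of the interval whose first part is 2. Below, `vR` gives the greatest
  -- element `R` whose first part is 1. As `X` exceeds `R` at 1, comparability forces `R ≤ X`
  -- everywhere.
  have vX : IsFibSeq n fun j => if j = 0 then 0 else max (P.1 j) (min (j + 1) n) := by
    refine ⟨rfl, fun j => ?_⟩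
    have := P.2.2 j
    have := P.2.1
    dsimp only
    rcases Nat.eq_zero_or_pos j with rfl | hj
    · simp
      omega
    · rw [if_neg (by omega), if_neg (by omega)]
      omega
  have vR : IsFibSeq n fun j => min (Q.1 j) (2 * j - 1) := by
    refine ⟨by simp, fun j => ?_⟩
    have := Q.2.2 j
    have := Q.2.1
    dsimp only
    rcases Nat.eq_zero_or_pos j with rfl | hj <;> omega
  have hX : (⟨_, vX⟩ : FibSeq n) ∈ Set.Icc P Q := by
    refine ⟨fun j => ?_, fun j => ?_⟩
    · change P.1 j ≤ if j = 0 then 0 else max (P.1 j) (min (j + 1) n)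
      split_ifs with hj
      · rw [hj, P.2.1]
      · exact le_max_left _ _
    · change (if j = 0 then 0 else max (P.1 j) (min (j + 1) n)) ≤ Q.1 j
      have := hPQ j
      have := hQb j
      split_ifs with hj <;> omega
  have hR : (⟨_, vR⟩ : FibSeq n) ∈ Set.Icc P Q := by
    refine ⟨fun j => ?_, fun j => min_le_left _ _⟩
    change P.1 j ≤ min (Q.1 j) (2 * j - 1)
    have := hPQ j
    have := hPb j
    have := P.2.1
    rcases Nat.eq_zero_or_pos j with rfl | hj <;> omega
  have hRX : ∀ j, 1 ≤ j → min (Q.1 j) (2 * j - 1) ≤ max (P.1 j) (min (j + 1) n) := by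
    rcases h.comparable hX hR with hc | hc
    · have := hc 1
      change (if 1 = 0 then 0 else max (P.1 1) (min (1 + 1) n)) ≤ min (Q.1 1) (2 * 1 - 1) at this
      simp at this
      omega
    · intro j hj
      have := hc j
      change min (Q.1 j) (2 * j - 1) ≤ if j = 0 then 0 else max (P.1 j) (min (j + 1) n) at this
      rwa [if_neg (by omega)] at this
  have ones : ∀ m, 1 ≤ m → (∀ j ≤ m, P.1 j = j) →
      (∀ j, Q.1 j = P.1 j + if 1 ≤ j ∧ j ≤ m then 1 else 0) → (P, Q) ∈ onesPairs n k :=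
    fun m hm h1 h2 => by
      obtain rfl := h.length_unique (isChainInterval_of_ones h1 h2)
      exact ⟨hm, h1, h2⟩
  have twos : ∀ m, 2 ≤ m → (∀ j, 1 ≤ j → j ≤ m → P.1 j = 2 * j - 1) →
      (∀ j, Q.1 j = P.1 j + if 1 ≤ j ∧ j ≤ m then 1 else 0) → (P, Q) ∈ twosPairs n k :=
    fun m hm h1 h2 => by
      obtain rfl := h.length_unique (isChainInterval_of_twos h1 h2)
      exact ⟨hm, h1, h2⟩
  have hP2 := P.2.2 1
  have hPn : ∀ j, n ≤ j → P.1 j = n := fun j hj => by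
    have := P.2.bounds j
    have := P.2.le j
    omega
  by_cases h2 : P.1 2 = 2
  · have hge : ∀ j, 3 ≤ j → Q.1 j = max (P.1 j) (min (j + 1) n) := fun j hj => by
      have h3 := hRX j (by omega)
      have h4 := hPQ j
      have h5 := hQb j (by omega)
      have h6 := (P.2.growth_of_le (a := 2) (b := j) (by omega)).2
      omega
    by_cases hQ2 : Q.1 2 = max (P.1 2) (min 3 n)
    · left; left
      have hQX : ∀ j, 1 ≤ j → Q.1 j = max (P.1 j) (min (j + 1) n) := fun j hj => by
        rcases (by omega : j = 1 ∨ j = 2 ∨ 3 ≤ j) with rfl | rfl | h3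
        · rw [hQ1, hP1]
          omega
        · exact hQ2
        · exact hge j h3
      have hb : ∀ m, (P.1 m = m ∧ m + 1 ≤ n) → m ≤ n := fun m hm => by omega
      classical
      -- `m` counts the initial ones of `P`; the bound `m + 1 ≤ n` drops the last one of `1ⁿ`, where
      -- `P` and `Q` have both reached `n`.
      set m := Nat.findGreatest (fun m => P.1 m = m ∧ m + 1 ≤ n) n with hm
      have h1m : 1 ≤ m := Nat.le_findGreatest (by omega) ⟨hP1, hn2⟩
      have hspec : P.1 m = m ∧ m + 1 ≤ n :=
        Nat.findGreatest_spec (P := fun m => P.1 m = m ∧ m + 1 ≤ n) (m := 1) (by omega)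
          ⟨hP1, hn2⟩
      have hPm : ∀ j ≤ m, P.1 j = j := fun j hj => by
        have := P.2.bounds j
        have := (P.2.growth_of_le hj).1
        omega
      refine ones m h1m hPm fun j => ?_
      rcases Nat.eq_zero_or_pos j with rfl | hj
      · simp [P.2.1, Q.2.1]
      · rw [hQX j hj]
        by_cases hjm : j ≤ m
        · rw [if_pos ⟨hj, hjm⟩, hPm j hjm]
          omega
        · rw [if_neg (by omega)]
          have h4 : ¬ (P.1 j = j ∧ j + 1 ≤ n) := fun h4 =>
            hjm (Nat.le_findGreatest (hb j h4) h4)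
          have := P.2.bounds j
          omega
    · right
      have h3 := hPQ 2
      have h4 := hQb 2 (by omega)
      have h5 := Q.2.2 1
      have h6 := Q.2.2 2
      have h7 := hge 3 le_rfl
      have h8 := P.2.2 2
      simp only [Nat.reduceAdd] at *
      -- Here `Q.1 2 = 4`, so `Q.1 3 ≥ min n 5`, whereas `h7` and `P.1 3 ≤ 4` give `Q.1 3 ≤ 4`.
      obtain rfl : n = 4 := by omega
      have hQ' : ∀ j, Q.1 j = min (2 * j) 4 := fun j => by
        have h9 := Q.2.bounds j
        have h10 := Q.2.le j
        rcases (by omega : j = 0 ∨ j = 1 ∨ j = 2 ∨ j = 3 ∨ 4 ≤ j) with rfl | rfl | rfl | rfl | h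
          <;> omega
      rcases (by omega : P.1 3 = 3 ∨ P.1 3 = 4) with h9 | h9
      · have hP' : ∀ j, P.1 j = min j 4 := fun j => by
          have h10 := P.2.bounds j
          have h11 := P.2.le j
          rcases (by omega : j = 0 ∨ j = 1 ∨ j = 2 ∨ j = 3 ∨ 4 ≤ j) with
            rfl | rfl | rfl | rfl | h <;> omega
        obtain rfl := h.length_unique (isChainInterval_four hP' hQ')
        exact Or.inl ⟨rfl, rfl, hP', hQ'⟩
      · have hP' : ∀ j, P.1 j = if j ≤ 2 then j else 4 := fun j => by
          have h10 := P.2.bounds j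
          have h11 := P.2.le j
          rcases (by omega : j = 0 ∨ j = 1 ∨ j = 2 ∨ j = 3 ∨ 4 ≤ j) with
            rfl | rfl | rfl | rfl | h <;> split_ifs <;> omega
        obtain rfl := h.length_unique (isChainInterval_three hP' hQ')
        exact Or.inr ⟨rfl, rfl, hP', hQ'⟩
  · left
    simp only [Nat.reduceAdd] at hP2
    have h23 : P.1 2 = 3 ∧ 3 ≤ n := by omega
    have hPg : ∀ j, 2 ≤ j → min n (j + 1) ≤ P.1 j := fun j hj => by
      have := (P.2.growth_of_le hj).1
      omega
    -- By `hPg`, `X` agrees with `P` from index 2 on, so `R ≤ X` bounds `min (Q.1 j) (2 * j - 1)` by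
    -- `P.1 j`.
    have hPt : ∀ j, 1 ≤ j → P.1 j < Q.1 j → P.1 j = 2 * j - 1 := fun j hj hlt => by
      rcases (by omega : j = 1 ∨ 2 ≤ j) with rfl | hj2
      · exact hP1
      · have := hRX j hj
        have := hPg j hj2
        have := hPb j hj
        omega
    have hPn' : ∀ m, P.1 m < Q.1 m → m ≤ n := fun m hm => by
      by_contra hc
      have := hPn m (by omega)
      have := Q.2.le m
      omega
    classical
    set m := Nat.findGreatest (fun m => P.1 m < Q.1 m) n with hm
    have h1m : 1 ≤ m := Nat.le_findGreatest (by omega) (by omega)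
    have hspec : P.1 m < Q.1 m :=
      Nat.findGreatest_spec (P := fun m => P.1 m < Q.1 m) (m := 1) (by omega) (by omega)
    have hPm := hPt m h1m hspec
    have hPj : ∀ j, 1 ≤ j → j ≤ m → P.1 j = 2 * j - 1 := fun j hj hjm => by
      have := (P.2.growth_of_le hjm).2
      have := hPb j hj
      omega
    have hQj : ∀ j, Q.1 j = P.1 j + if 1 ≤ j ∧ j ≤ m then 1 else 0 := fun j => by
      rcases Nat.eq_zero_or_pos j with rfl | hj
      · simp [P.2.1, Q.2.1]
      · by_cases hjm : j ≤ m
        · have := hPj j hj hjm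
          have := (Q.2.growth_of_le hjm).2
          have := Q.2.bounds j
          rw [if_pos ⟨hj, hjm⟩]
          omega
        · rw [if_neg (by omega)]
          have h4 : ¬ P.1 j < Q.1 j := fun h4 => hjm (Nat.le_findGreatest (hPn' j h4) h4)
          have := hPQ j
          omega
    -- For `m = 1` the two families overlap; these pairs are assigned to the ones.
    rcases (by omega : m = 1 ∨ 2 ≤ m) with hm1 | hm2
    · left
      rw [hm1] at hQj
      refine ones 1 le_rfl (fun j hj => ?_) hQj
      rcases (by omega : j = 0 ∨ j = 1) with rfl | rfl
      · exact P.2.1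
      · exact hP1
    · right
      exact twos m hm2 hPj hQj

theorem irreduciblePairs_eq (n k : ℕ) : irreduciblePairs n k =
    (onesPairs n k ∪ twosPairs n k) ∪ (longPair n k ∪ shortPair n k) := by
  apply Set.Subset.antisymm
  · rintro ⟨P, Q⟩ ⟨h1, h2, h⟩
    exact mem_of_isChainInterval h1 h2 h
  · rintro ⟨P, Q⟩ ((⟨hk, hP, hQ⟩ | ⟨hk, hP, hQ⟩) | (⟨rfl, rfl, hP, hQ⟩ | ⟨rfl, rfl, hP, hQ⟩))
    · have h1 := hP 1 hk
      have h2 := hQ 1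
      rw [if_pos ⟨le_rfl, hk⟩] at h2
      exact ⟨h1, by rw [h2, h1], isChainInterval_of_ones hP hQ⟩
    · have h1 := hP 1 le_rfl (by omega)
      have h2 := hQ 1
      rw [if_pos ⟨le_rfl, by omega⟩] at h2
      exact ⟨h1, by rw [h2, h1], isChainInterval_of_twos hP hQ⟩
    · exact ⟨hP 1, hQ 1, isChainInterval_four hP hQ⟩
    · exact ⟨hP 1, hQ 1, isChainInterval_three hP hQ⟩

end FibSeq

/-! ### Recursion and enumeration of the chains. -/

namespace FibSeq

open Set

variable {n k m : ℕ} {g : ℕ → ℕ}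

/-- The sequences that agree with `g` up to the index `m`. -/
def cylinder (n m : ℕ) (g : ℕ → ℕ) : Set (FibSeq n) :=
  {f | ∀ j ≤ m, f.1 j = g j}

/-- Convexity ensures that an interval with both ends in a cylinder lies in it, so chains can be
counted after deleting the common initial segment. -/
theorem ordConnected_cylinder : (cylinder n m g).OrdConnected := by
  refine ⟨fun a ha b hb x hx j hj => ?_⟩
  have h1 : a.1 j ≤ x.1 j := hx.1 j
  have h2 : x.1 j ≤ b.1 j := hx.2 j
  rw [ha j hj] at h1
  rw [hb j hj] at h2
  omega

/-- `g` is, up to the index `m`, an initial segment of sequences in `FibSeq n`. -/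
def IsInitialSegment (n m : ℕ) (g : ℕ → ℕ) : Prop :=
  g 0 = 0 ∧ g m ≤ n ∧ ∀ j < m, min n (g j + 1) ≤ g (j + 1) ∧ g (j + 1) ≤ min n (g j + 2)

theorem isFibSeq_shift (f : FibSeq n) (m : ℕ) :
    IsFibSeq (n - f.1 m) fun j => f.1 (j + m) - f.1 m := by
  refine ⟨by simp, fun j => ?_⟩
  have h1 := f.2.2 (j + m)
  have h2 := f.2.growth_of_le (show m ≤ j + m by omega)
  have h4 := f.2.le (j + m)
  have h5 := f.2.le (j + m + 1)
  have h3 : f.1 m ≤ f.1 (j + m) := by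
    have := f.2.le m
    omega
  dsimp only
  rw [show j + 1 + m = j + m + 1 by omega]
  omega

theorem isFibSeq_graft (hg : IsInitialSegment n m g) (f : FibSeq (n - g m)) :
    IsFibSeq n fun j => if j ≤ m then g j else g m + f.1 (j - m) := by
  obtain ⟨h0, hm, hs⟩ := hg
  refine ⟨by simp [h0], fun j => ?_⟩
  dsimp only
  rcases lt_trichotomy j m with h | rfl | h
  · rw [if_pos (by omega), if_pos (by omega)]
    exact hs j h
  · have := f.2.2 0
    rw [f.2.1] at this
    rw [if_pos le_rfl, if_neg (by omega), show j + 1 - j = 0 + 1 by omega]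
    omega
  · have := f.2.2 (j - m)
    rw [if_neg (by omega), if_neg (by omega), show j + 1 - m = j - m + 1 by omega]
    omega

/-- The sequences with a given initial segment are determined by the rest. -/
def cylinderIso (hg : IsInitialSegment n m g) : cylinder n m g ≃o FibSeq (n - g m) where
  toFun f := ⟨fun j => f.1.1 (j + m) - g m, by
    have := isFibSeq_shift f.1 m
    rwa [f.2 m le_rfl] at this⟩
  invFun f := ⟨⟨_, isFibSeq_graft hg f⟩, fun j hj => if_pos hj⟩
  left_inv f := by
    refine Subtype.ext (Subtype.ext (funext fun j => ?_))
    have h1 := f.2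
    dsimp only
    split_ifs with hj
    · exact (h1 j hj).symm
    · have h2 := f.1.2.growth_of_le (show m ≤ j by omega)
      have h3 := f.1.2.le m
      rw [h1 m le_rfl] at h2 h3
      rw [show j - m + m = j by omega]
      omega
  right_inv f := by
    refine Subtype.ext (funext fun j => ?_)
    dsimp only
    rcases Nat.eq_zero_or_pos j with rfl | hj
    · simp [f.2.1]
    · rw [if_neg (by omega), Nat.add_sub_cancel]
      omega
  map_rel_iff' := by
    intro a b
    constructor
    · intro h j
      change a.1.1 j ≤ b.1.1 j
      by_cases hj : j ≤ m
      · rw [a.2 j hj, b.2 j hj]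
      · have h1 : a.1.1 (j - m + m) - g m ≤ b.1.1 (j - m + m) - g m := h (j - m)
        rw [show j - m + m = j by omega] at h1
        have h2 := b.1.2.growth_of_le (show m ≤ j by omega)
        have h3 := b.1.2.le m
        rw [b.2 m le_rfl] at h2 h3
        omega
    · intro h j
      exact Nat.sub_le_sub_right (h (j + m)) _

theorem ncard_cylinder (hg : IsInitialSegment n m g) :
    (cylinder n m g).ncard = Nat.card (FibSeq (n - g m)) := by
  rw [← Nat.card_coe_set_eq]
  exact Nat.card_congr (cylinderIso hg).toEquiv

/-- The pairs that bound a chain of length `k`. -/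
def chainPairs (n k : ℕ) : Set (FibSeq n × FibSeq n) :=
  {p | IsChainInterval p.1 p.2 k}

theorem ncard_chainPairs_cylinder (hg : IsInitialSegment n m g) :
    {p : FibSeq n × FibSeq n | p.1 ∈ cylinder n m g ∧ p.2 ∈ cylinder n m g ∧
      IsChainInterval p.1 p.2 k}.ncard = (chainPairs (n - g m) k).ncard := by
  rw [← Nat.card_coe_set_eq, ← Nat.card_coe_set_eq]
  let e := cylinderIso hg
  have key : ∀ a b : cylinder n m g,
      IsChainInterval (e a) (e b) k ↔ IsChainInterval (a : FibSeq n) (b : FibSeq n) k :=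
    fun a b => (IsChainInterval.orderIso_iff e).trans
      (IsChainInterval.subtype_iff ordConnected_cylinder).symm
  refine Nat.card_congr
    { toFun := fun p => ⟨(e ⟨p.1.1, p.2.1⟩, e ⟨p.1.2, p.2.2.1⟩), (key _ _).2 p.2.2.2⟩
      invFun := fun p => ⟨((e.symm p.1.1 : FibSeq n), (e.symm p.1.2 : FibSeq n)),
        (e.symm p.1.1).2, (e.symm p.1.2).2, (key _ _).1 (by
          rw [e.apply_symm_apply, e.apply_symm_apply]; exact p.2)⟩
      left_inv := fun p => by simp
      right_inv := fun p => by simp }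

instance finite (n : ℕ) : Finite (FibSeq n) := by
  refine Finite.of_injective
    (fun (f : FibSeq n) (j : Fin n) => (⟨f.1 j, Nat.lt_succ_of_le (f.2.le j)⟩ : Fin (n + 1)))
    fun f f' h => Subtype.ext (funext fun j => ?_)
  by_cases hj : j < n
  · exact congrArg Fin.val (congrFun h ⟨j, hj⟩)
  · have h1 := f.2.bounds j
    have h2 := f'.2.bounds j
    have h3 := f.2.le j
    have h4 := f'.2.le j
    omega

theorem eq_of_le_one (hn : n ≤ 1) (f f' : FibSeq n) : f = f' := by
  refine Subtype.ext (funext fun j => ?_)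
  rcases Nat.eq_zero_or_pos j with rfl | hj
  · rw [f.2.1, f'.2.1]
  · have h1 := f.2.bounds j
    have h2 := f'.2.bounds j
    have h3 := f.2.le j
    have h4 := f'.2.le j
    omega

instance nonempty (n : ℕ) : Nonempty (FibSeq n) :=
  ⟨⟨fun j => min n j, by simp, fun j => by dsimp only; omega⟩⟩

theorem card_of_le_one (hn : n ≤ 1) : Nat.card (FibSeq n) = 1 :=
  Nat.card_eq_one_iff_unique.2 ⟨⟨eq_of_le_one hn⟩, inferInstance⟩

theorem isInitialSegment_one (n : ℕ) : IsInitialSegment (n + 2) 1 id :=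
  ⟨rfl, by simp, fun j hj => by simp only [id]; omega⟩

theorem isInitialSegment_two (n : ℕ) : IsInitialSegment (n + 2) 1 (2 * ·) :=
  ⟨rfl, by simp, fun j hj => by dsimp only; omega⟩

theorem mem_cylinder_one {f : FibSeq n} : f ∈ cylinder n 1 id ↔ f.1 1 = 1 := by
  constructor
  · intro h
    exact h 1 le_rfl
  · intro h j hj
    rcases (by omega : j = 0 ∨ j = 1) with rfl | rfl
    · exact f.2.1
    · exact h

theorem mem_cylinder_two {f : FibSeq n} : f ∈ cylinder n 1 (2 * ·) ↔ f.1 1 = 2 := by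
  constructor
  · intro h
    exact h 1 le_rfl
  · intro h j hj
    rcases (by omega : j = 0 ∨ j = 1) with rfl | rfl
    · exact f.2.1
    · exact h

theorem apply_one (f : FibSeq (n + 2)) : f.1 1 = 1 ∨ f.1 1 = 2 := by
  have := f.2.bounds 1
  omega

theorem card_add_two (n : ℕ) :
    Nat.card (FibSeq (n + 2)) = Nat.card (FibSeq (n + 1)) + Nat.card (FibSeq n) := by
  have h1 : (cylinder (n + 2) 1 id).ncard = Nat.card (FibSeq (n + 1)) :=
    ncard_cylinder (isInitialSegment_one n)
  have h2 : (cylinder (n + 2) 1 (2 * ·)).ncard = Nat.card (FibSeq n) :=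
    ncard_cylinder (isInitialSegment_two n)
  rw [← h1, ← h2, ← Set.ncard_univ, ← Set.ncard_union_eq]
  · congr 1
    ext f
    simpa [mem_cylinder_one, mem_cylinder_two] using apply_one f
  · rw [Set.disjoint_left]
    intro f
    rw [mem_cylinder_one, mem_cylinder_two]
    omega

/-- The three terms are the possible first parts of the ends: both 1, both 2, or 1 below 2. -/
theorem ncard_chainPairs_add_two (n k : ℕ) :
    (chainPairs (n + 2) k).ncard = (chainPairs (n + 1) k).ncard + (chainPairs n k).ncard +
      (irreduciblePairs (n + 2) k).ncard := by
  have h1 := ncard_chainPairs_cylinder (k := k) (isInitialSegment_one n)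
  have h2 := ncard_chainPairs_cylinder (k := k) (isInitialSegment_two n)
  change _ = (chainPairs (n + 1) k).ncard at h1
  change _ = (chainPairs n k).ncard at h2
  simp only [mem_cylinder_one] at h1
  simp only [mem_cylinder_two] at h2
  rw [← h1, ← h2, ← Set.ncard_union_eq, ← Set.ncard_union_eq]
  · congr 1
    ext ⟨P, Q⟩
    simp only [chainPairs, irreduciblePairs, mem_union, mem_ofPred_eq]
    constructor
    · intro h
      have h3 : P.1 1 ≤ Q.1 1 := h.le 1
      have h4 := apply_one P
      have h5 := apply_one Q
      rcases (by omega : (P.1 1 = 1 ∧ Q.1 1 = 1) ∨ (P.1 1 = 2 ∧ Q.1 1 = 2) ∨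
        (P.1 1 = 1 ∧ Q.1 1 = 2)) with h6 | h6 | h6 <;> tauto
    · tauto
  · rw [Set.disjoint_left]
    rintro ⟨P, Q⟩
    simp only [irreduciblePairs, mem_union, mem_ofPred_eq]
    omega
  · rw [Set.disjoint_left]
    rintro ⟨P, Q⟩
    simp only [mem_ofPred_eq]
    omega

theorem ncard_chainPairs_of_le_one (hn : n ≤ 1) (k : ℕ) :
    (chainPairs n k).ncard = if k = 0 then 1 else 0 := by
  obtain ⟨f⟩ := nonempty n
  have hf : ∀ P : FibSeq n, P = f := fun P => eq_of_le_one hn P f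
  split_ifs with hk
  · rw [Set.ncard_eq_one]
    refine ⟨(f, f), ?_⟩
    ext ⟨P, Q⟩
    simp only [chainPairs, mem_ofPred_eq, hk, IsChainInterval.zero_iff, mem_singleton_iff,
      Prod.mk.injEq]
    exact ⟨fun _ => ⟨hf P, hf Q⟩, fun _ => eq_of_le_one hn P Q⟩
  · rw [Set.ncard_eq_zero]
    ext ⟨P, Q⟩
    simp only [chainPairs, mem_ofPred_eq, mem_empty_iff_false, iff_false]
    intro h
    have h0 := IsChainInterval.zero_iff.2 (eq_of_le_one hn P Q)
    exact hk (h.length_unique h0)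

/-- `d` is the size of the parts after the first one, so `d = 1` and `d = 2` serve the two families.
The raised sequence has the value `d * (k - 1) + 2` at `k`, and `hk` leaves room for its next part.
-/
theorem isFibSeq_add_indicator (P : FibSeq n) {d : ℕ} (hd : 1 ≤ d ∧ d ≤ 2)
    (hP : ∀ j, 1 ≤ j → j ≤ k → P.1 j = d * (j - 1) + 1)
    (hn : d * (k - 1) + 2 ≤ n) (hk : min n (d * (k - 1) + 3) ≤ P.1 (k + 1)) :
    IsFibSeq n fun j => P.1 j + if 1 ≤ j ∧ j ≤ k then 1 else 0 := by
  refine ⟨by simp [P.2.1], fun j => ?_⟩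
  have h0 := P.2.1
  have h1 := P.2.2 j
  have h3 := hP j
  have h4 := hP (j + 1)
  obtain rfl | rfl : d = 1 ∨ d = 2 := by omega
  all_goals
    dsimp only
    rcases lt_trichotomy j k with h | rfl | h <;>
      rcases Nat.eq_zero_or_pos j with rfl | hj <;> split_ifs <;>
      (try simp only [zero_add] at *) <;> omega

/-- `P` determines `Q`, and validity of `Q` forces `P` to be `min n (k + 2)` at `k + 1`, after which
it is free. For `n = k + 1` the truncated subtraction gives `FibSeq 0`, which accounts for the one
pair without a part 2 in `P`. -/
theorem ncard_onesPairs (n k : ℕ) : (onesPairs n k).ncard =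
    if 1 ≤ k ∧ k + 1 ≤ n then Nat.card (FibSeq (n - (k + 2))) else 0 := by
  split_ifs with h
  · obtain ⟨hk, hn⟩ := h
    let g : ℕ → ℕ := fun j => if j ≤ k then j else min n (k + 2)
    have hgj : ∀ j ≤ k, g j = j := fun j hj => if_pos hj
    have hgk : g (k + 1) = min n (k + 2) := if_neg (by omega)
    have hg : IsInitialSegment n (k + 1) g := by
      refine ⟨hgj 0 (by omega), by omega, fun j hj => ?_⟩
      rcases (by omega : j < k ∨ j = k) with h | rfl
      · rw [hgj j h.le, hgj (j + 1) h]
        omega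
      · rw [hgk, hgj j le_rfl]
        omega
    have h1 := ncard_cylinder hg
    rw [hgk, show n - min n (k + 2) = n - (k + 2) by omega] at h1
    rw [← h1]
    refine Set.ncard_congr (fun p _ => p.1) ?_ ?_ ?_
    · rintro ⟨P, Q⟩ ⟨-, hP, hQ⟩ j hj
      rcases (by omega : j ≤ k ∨ j = k + 1) with h | rfl
      · rw [hgj j h]
        exact hP j h
      · have h2 := hQ (k + 1)
        have h3 := hQ k
        have h4 := Q.2.2 k
        have h5 := P.2.2 k
        have h6 := hP k le_rfl
        rw [if_neg (by omega)] at h2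
        rw [if_pos (by omega)] at h3
        rw [hgk]
        dsimp only at *
        omega
    · rintro ⟨P, Q⟩ ⟨P', Q'⟩ ⟨-, hP, hQ⟩ ⟨-, hP', hQ'⟩ (rfl : P = P')
      refine Prod.ext rfl (Subtype.ext (funext fun j => ?_))
      rw [hQ j, hQ' j]
    · intro P hP
      have hP' : ∀ j ≤ k, P.1 j = j := fun j hj => (hP j (by omega)).trans (hgj j hj)
      refine ⟨(P, ⟨_, isFibSeq_add_indicator (d := 1) (k := k) P (by omega) ?_ (by omega) ?_⟩),
        ⟨hk, hP', fun _ => rfl⟩, rfl⟩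
      · intro j hj hjk
        rw [hP' j hjk]
        omega
      · rw [hP (k + 1) le_rfl, hgk]
        omega
  · rw [Set.ncard_eq_zero]
    ext ⟨P, Q⟩
    simp only [mem_empty_iff_false, iff_false]
    rintro ⟨hk, hP, hQ⟩
    have h1 := hQ k
    rw [if_pos ⟨hk, le_rfl⟩, hP k le_rfl] at h1
    have := Q.2.le k
    dsimp only at *
    omega

/-- As for the ones, now with `P` forced to be `min n (2 * k + 1)` at `k + 1`; truncation occurs for
`n = 2 * k`. -/
theorem ncard_twosPairs (n k : ℕ) : (twosPairs n k).ncard =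
    if 2 ≤ k ∧ 2 * k ≤ n then Nat.card (FibSeq (n - (2 * k + 1))) else 0 := by
  split_ifs with h
  · obtain ⟨hk, hn⟩ := h
    let g : ℕ → ℕ := fun j => min n (2 * j - 1)
    have hgj : ∀ j, g j = min n (2 * j - 1) := fun j => rfl
    have hg : IsInitialSegment n (k + 1) g := by
      refine ⟨by simp [hgj], by rw [hgj]; omega, fun j hj => ?_⟩
      rw [hgj, hgj]
      omega
    have h1 := ncard_cylinder hg
    rw [hgj, show n - min n (2 * (k + 1) - 1) = n - (2 * k + 1) by omega] at h1
    rw [← h1]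
    refine Set.ncard_congr (fun p _ => p.1) ?_ ?_ ?_
    · rintro ⟨P, Q⟩ ⟨-, hP, hQ⟩ j hj
      rw [hgj]
      rcases (by omega : j = 0 ∨ (1 ≤ j ∧ j ≤ k) ∨ j = k + 1) with rfl | h | rfl
      · simpa using P.2.1
      · have := hP j h.1 h.2
        dsimp only at *
        omega
      · have h2 := hQ (k + 1)
        have h3 := hQ k
        have h4 := Q.2.2 k
        have h5 := P.2.2 k
        have h6 := hP k (by omega) le_rfl
        rw [if_neg (by omega)] at h2
        rw [if_pos (by omega)] at h3
        dsimp only at *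
        omega
    · rintro ⟨P, Q⟩ ⟨P', Q'⟩ ⟨-, hP, hQ⟩ ⟨-, hP', hQ'⟩ (rfl : P = P')
      refine Prod.ext rfl (Subtype.ext (funext fun j => ?_))
      rw [hQ j, hQ' j]
    · intro P hP
      have hP' : ∀ j, 1 ≤ j → j ≤ k → P.1 j = 2 * j - 1 := fun j hj hjk => by
        rw [hP j (by omega), hgj]
        omega
      refine ⟨(P, ⟨_, isFibSeq_add_indicator (d := 2) (k := k) P (by omega) ?_ (by omega) ?_⟩),
        ⟨hk, hP', fun _ => rfl⟩, rfl⟩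
      · intro j hj hjk
        rw [hP' j hj hjk]
        omega
      · rw [hP (k + 1) le_rfl, hgj]
        omega
  · rw [Set.ncard_eq_zero]
    ext ⟨P, Q⟩
    simp only [mem_empty_iff_false, iff_false]
    rintro ⟨hk, hP, hQ⟩
    have h1 := hQ k
    rw [if_pos ⟨by omega, le_rfl⟩, hP k (by omega) le_rfl] at h1
    have := Q.2.le k
    dsimp only at *
    omega

theorem ncard_longPair (n k : ℕ) :
    (longPair n k).ncard = if n = 4 ∧ k = 4 then 1 else 0 := by
  split_ifs with h
  · obtain ⟨rfl, rfl⟩ := h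
    rw [Set.ncard_eq_one]
    refine ⟨(⟨fun j => min j 4, rfl, fun j => by dsimp only; omega⟩,
      ⟨fun j => min (2 * j) 4, rfl, fun j => by dsimp only; omega⟩), ?_⟩
    ext ⟨P, Q⟩
    simp [longPair, Subtype.ext_iff, funext_iff]
  · rw [Set.ncard_eq_zero]
    ext p
    simp only [longPair, mem_ofPred_eq, mem_empty_iff_false, iff_false]
    tauto

theorem ncard_shortPair (n k : ℕ) :
    (shortPair n k).ncard = if n = 4 ∧ k = 3 then 1 else 0 := by
  split_ifs with h
  · obtain ⟨rfl, rfl⟩ := h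
    rw [Set.ncard_eq_one]
    refine ⟨(⟨fun j => if j ≤ 2 then j else 4, rfl,
      fun j => by dsimp only; split_ifs <;> omega⟩,
      ⟨fun j => min (2 * j) 4, rfl, fun j => by dsimp only; omega⟩), ?_⟩
    ext ⟨P, Q⟩
    simp [shortPair, Subtype.ext_iff, funext_iff]
  · rw [Set.ncard_eq_zero]
    ext p
    simp only [shortPair, mem_ofPred_eq, mem_empty_iff_false, iff_false]
    tauto

theorem ncard_irreduciblePairs (n k : ℕ) : (irreduciblePairs n k).ncard =
    ((if 1 ≤ k ∧ k + 1 ≤ n then Nat.card (FibSeq (n - (k + 2))) else 0) +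
      if 2 ≤ k ∧ 2 * k ≤ n then Nat.card (FibSeq (n - (2 * k + 1))) else 0) +
    ((if n = 4 ∧ k = 4 then 1 else 0) + if n = 4 ∧ k = 3 then 1 else 0) := by
  rw [irreduciblePairs_eq, Set.ncard_union_eq, Set.ncard_union_eq, Set.ncard_union_eq,
    ncard_onesPairs, ncard_twosPairs, ncard_longPair, ncard_shortPair]
  · rw [Set.disjoint_left]
    rintro ⟨P, Q⟩ ⟨-, h, -⟩ ⟨-, h', -⟩
    omega
  -- For `2 ≤ k` the families are separated by the value of `P` at 2, which is 2 or 3; the sporadic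
  -- pairs are separated from both by a gap of 2 between `P` and `Q` there.
  · rw [Set.disjoint_left]
    rintro ⟨P, Q⟩ ⟨-, hP, -⟩ ⟨hk, hP', -⟩
    have h1 := hP 2 hk
    have h2 := hP' 2 (by omega) hk
    omega
  · rw [Set.disjoint_left]
    rintro ⟨P, Q⟩ h h'
    have h1 : Q.1 2 ≤ P.1 2 + 1 := by
      rcases h with ⟨-, -, hQ⟩ | ⟨-, -, hQ⟩ <;>
      · have := hQ 2
        dsimp only at this
        split_ifs at this <;> omega
    rcases h' with ⟨-, -, hP, hQ⟩ | ⟨-, -, hP, hQ⟩ <;>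
    · have h2 := hP 2
      have h3 := hQ 2
      simp at h2 h3
      omega

end FibSeq

/-! ### From Dyck paths to compositions. -/

namespace FibDyck

open DyckStep

/-- The number of down steps before the `j`-th up step of `l`, or the number of all down steps
when `l` has fewer than `j` up steps. -/
def downsBefore : List DyckStep → ℕ → ℕ
  | _, 0 => 0
  | [], _ + 1 => 0
  | D :: l, j + 1 => downsBefore l (j + 1) + 1
  | U :: l, j + 1 => downsBefore l j

@[simp] theorem downsBefore_zero (l : List DyckStep) : downsBefore l 0 = 0 := by
  cases l <;> rfl

@[simp] theorem downsBefore_nil (j : ℕ) : downsBefore [] j = 0 := by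
  cases j <;> rfl

@[simp] theorem downsBefore_D_cons (l : List DyckStep) (j : ℕ) :
    downsBefore (D :: l) (j + 1) = downsBefore l (j + 1) + 1 := rfl

@[simp] theorem downsBefore_U_cons (l : List DyckStep) (j : ℕ) :
    downsBefore (U :: l) (j + 1) = downsBefore l j := rfl

theorem downsBefore_le (l : List DyckStep) (j : ℕ) : downsBefore l j ≤ l.count D := by
  induction l generalizing j with
  | nil => simp
  | cons a l ih =>
    cases j with
    | zero => simp
    | succ j =>
      cases a with
      | U => simpa using ih j
      | D => simpa using ih (j + 1)

theorem downsBefore_of_lt {l : List DyckStep} {j : ℕ} (h : l.count U < j) :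
    downsBefore l j = l.count D := by
  induction l generalizing j with
  | nil => simp
  | cons a l ih =>
    cases j with
    | zero => simp at h
    | succ j =>
      cases a with
      | U => simpa using ih (by simpa using h)
      | D => simpa using ih (by simpa using h)

/-- For positive `j`, the `j`-th up step is the step number `j + downsBefore l j`. This adjunction
turns comparison of heights into comparison of `downsBefore`. -/
theorem le_count_take_iff {l : List DyckStep} {j : ℕ} (hj : j ≤ l.count U) (i : ℕ) :
    j ≤ (l.take i).count U ↔ j + downsBefore l j ≤ i := by
  induction l generalizing i j with
  | nil =>
    have : j = 0 := by simpa using hj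
    simp [this]
  | cons a l ih =>
    cases j with
    | zero => simp
    | succ j =>
      cases i with
      | zero => simp
      | succ i =>
        cases a with
        | U =>
          have := ih (j := j) (by simpa using hj) i
          simp only [List.take_succ_cons, List.count_cons_self, downsBefore_U_cons]
          omega
        | D =>
          have := ih (j := j + 1) (by simpa using hj) i
          simp only [List.take_succ_cons, downsBefore_D_cons]
          rw [List.count_cons_of_ne (by simp)]
          omega

theorem downsBefore_le_iff {l l' : List DyckStep} (hU : l.count U = l'.count U)
    (hD : l.count D = l'.count D) :
    (∀ j, downsBefore l j ≤ downsBefore l' j) ↔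
      ∀ i, (l'.take i).count U ≤ (l.take i).count U := by
  constructor
  · intro h i
    have h1 : (l'.take i).count U ≤ l'.count U := (List.take_sublist i l').count_le _
    rw [le_count_take_iff (hU ▸ h1)]
    have := (le_count_take_iff h1 i).1 le_rfl
    have := h ((l'.take i).count U)
    omega
  · intro h j
    by_cases hj : j ≤ l'.count U
    · have h1 := (le_count_take_iff hj _).2 le_rfl
      have := (le_count_take_iff (hU ▸ hj) _).1 (h1.trans (h _))
      omega
    · rw [downsBefore_of_lt (by omega), downsBefore_of_lt (by omega), hD]

theorem count_add_count (l : List DyckStep) : l.count U + l.count D = l.length := by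
  induction l with
  | nil => simp
  | cons a l ih => cases a <;> simp <;> omega

variable {p n : ℕ}

theorem count_U_reverse (P : FibDyck p n) : P.path.toList.reverse.count U = n := by
  rw [List.count_reverse]; exact P.semilength_eq

theorem count_D_reverse (P : FibDyck p n) : P.path.toList.reverse.count D = n := by
  rw [List.count_reverse, ← P.path.count_U_eq_count_D]; exact P.semilength_eq

theorem count_take_reverse (P : FibDyck p n) {i : ℕ} (hi : i ≤ 2 * n) :
    ((P.path.toList.reverse.take (2 * n - i)).count U : ℤ) = n - (P.path.toList.take i).count U := by
  have h1 := P.semilength_eq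
  rw [DyckWord.semilength] at h1
  rw [List.take_reverse, List.count_reverse, P.length_toList, show 2 * n - (2 * n - i) = i by omega]
  have h2 : (P.path.toList.take i).count U + (P.path.toList.drop i).count U =
      P.path.toList.count U := by
    rw [← List.count_append, List.take_append_drop]
  omega

theorem le_iff_downsBefore (P Q : FibDyck p n) :
    P ≤ Q ↔ ∀ j, downsBefore P.path.toList.reverse j ≤ downsBefore Q.path.toList.reverse j := by
  have hord : ∀ (R : FibDyck p n) i, i ≤ 2 * n →
      R.ordinate i = 2 * (R.path.toList.take i).count U - i := fun R i hi => by
    have h := count_add_count (R.path.toList.take i)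
    rw [List.length_take, R.length_toList, min_eq_left hi] at h
    rw [ordinate]
    omega
  have hord' : ∀ (R : FibDyck p n) i, 2 * n ≤ i → R.ordinate i = R.ordinate (2 * n) :=
    fun R i hi => by
      rw [ordinate, ordinate, List.take_of_length_le (by rw [R.length_toList]; exact hi),
        List.take_of_length_le R.length_toList.le]
  rw [downsBefore_le_iff (by rw [P.count_U_reverse, Q.count_U_reverse])
    (by rw [P.count_D_reverse, Q.count_D_reverse])]
  constructor
  · intro h i
    by_cases hi : i ≤ 2 * n
    · have h1 := h (2 * n - i)
      rw [hord P _ (by omega), hord Q _ (by omega)] at h1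
      have h2 := P.count_take_reverse (i := 2 * n - i) (by omega)
      have h3 := Q.count_take_reverse (i := 2 * n - i) (by omega)
      rw [show 2 * n - (2 * n - i) = i by omega] at h2 h3
      omega
    · rw [List.take_of_length_le (by rw [List.length_reverse, Q.length_toList]; omega),
        List.take_of_length_le (by rw [List.length_reverse, P.length_toList]; omega),
        P.count_U_reverse, Q.count_U_reverse]
  · intro h
    have key : ∀ i, i ≤ 2 * n → P.ordinate i ≤ Q.ordinate i := fun i hi => by
      have h1 := h (2 * n - i)
      have h2 := P.count_take_reverse hi
      have h3 := Q.count_take_reverse hi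
      rw [hord P _ hi, hord Q _ hi]
      omega
    intro i
    rcases le_total i (2 * n) with hi | hi
    · exact key i hi
    · rw [hord' P i hi, hord' Q i hi]
      exact key _ le_rfl

end FibDyck

namespace FibDyck

open DyckStep

theorem downsBefore_succ_le {l : List DyckStep} (h : ¬ [D, D, D] <:+: l) (j : ℕ) :
    downsBefore l (j + 1) ≤ downsBefore l j + 2 := by
  induction l generalizing j with
  | nil => simp
  | cons a l ih =>
    have ih := ih (fun h' => h (List.infix_cons h'))
    cases a with
    | U =>
      cases j with
      | zero => simp
      | succ j => exact ih j
    | D =>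
      cases j with
      | zero =>
        rcases l with _ | ⟨_ | _, l⟩
        · simp
        · simp
        · rcases l with _ | ⟨_ | _, l⟩
          · simp
          · simp
          · exact absurd (List.infix_iff_prefix_suffix.2
              ⟨_, List.prefix_append [D, D, D] l, List.suffix_rfl⟩) h
      | succ j =>
        have := ih (j + 1)
        simp only [downsBefore_D_cons]
        omega

theorem count_D_eq_zero {l : List DyckStep} (h : ¬ [U, U, D] <:+: U :: U :: l) :
    l.count D = 0 := by
  induction l with
  | nil => simp
  | cons a l ih =>
    cases a with
    | U =>
      rw [List.count_cons_of_ne (by simp)]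
      exact ih fun h' => h (List.infix_cons h')
    | D =>
      exact absurd (List.infix_iff_prefix_suffix.2
        ⟨_, List.prefix_append [U, U, D] l, List.suffix_rfl⟩) h

/-- Two consecutive up steps can only be followed by up steps, so a zero increment occurs only when
all down steps are used up. For `j = 0` there is no preceding up step, and the Dyck condition is
needed instead. -/
theorem le_downsBefore_succ {l : List DyckStep} (h : ¬ [U, U, D] <:+: l) {j : ℕ} (hj : 1 ≤ j) :
    min (l.count D) (downsBefore l j + 1) ≤ downsBefore l (j + 1) := by
  induction l generalizing j with
  | nil => simp
  | cons a l ih =>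
    have ih := @ih fun h' => h (List.infix_cons h')
    obtain ⟨j, rfl⟩ : ∃ i, j = i + 1 := ⟨j - 1, by omega⟩
    cases a with
    | U =>
      rw [List.count_cons_of_ne (by simp)]
      cases j with
      | zero =>
        rcases l with _ | ⟨_ | _, l⟩
        · simp
        · rw [List.count_cons_of_ne (by simp), count_D_eq_zero h]
          simp
        · simp
      | succ j => exact ih (by omega)
    | D =>
      have := ih hj
      simp only [downsBefore_D_cons, List.count_cons_self]
      omega

theorem isFibSeq_downsBefore {n : ℕ} {l : List DyckStep} (hU : l.count U = n)
    (hD : l.count D = n) (hUUD : ¬ [U, U, D] <:+: l) (hDDD : ¬ [D, D, D] <:+: l)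
    (hdrop : ∀ i, (l.drop i).count D ≤ (l.drop i).count U) : IsFibSeq n (downsBefore l) := by
  refine ⟨downsBefore_zero l, fun j => ⟨?_, ?_⟩⟩
  · rcases Nat.eq_zero_or_pos j with rfl | hj
    · rcases l with _ | ⟨_ | _, l⟩
      · simp at hD
        simp [← hD]
      · have := hdrop 1
        simp at hU hD this
        omega
      · simp
    · exact hD ▸ le_downsBefore_succ hUUD hj
  · exact le_min (hD ▸ downsBefore_le l _) (downsBefore_succ_le hDDD j)

/-- The word is built by prepending `D U` or `D D U` for each part. Removing this block takes away
one `U` and one or two `D`s, so the induction needs words with a surplus of up steps; these end up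
in the first ascent of the path. -/
theorem exists_downsBefore_eq {n t : ℕ} (f : FibSeq n) (ht : n ≤ t) :
    ∃ l : List DyckStep, l.count U = t ∧ l.count D = n ∧ ¬ [U, U, D] <:+: l ∧
      ¬ [D, D, D] <:+: l ∧ (∀ i, (l.drop i).count D ≤ (l.drop i).count U) ∧
      downsBefore l = f.1 := by
  induction n using Nat.strong_induction_on generalizing t with
  | _ n ih =>
  rcases Nat.eq_zero_or_pos n with rfl | hn
  · refine ⟨List.replicate t U, by simp, by simp [List.count_replicate], ?_, ?_, ?_, ?_⟩
    · intro h
      have := h.subset (show D ∈ [U, U, D] by simp)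
      simp at this
    · intro h
      have := h.subset (show D ∈ [D, D, D] by simp)
      simp at this
    · intro i
      simp [List.count_replicate]
    · funext j
      have h1 := f.2.le j
      have h2 := downsBefore_le (List.replicate t U) j
      rw [List.count_replicate] at h2
      simp at h2
      omega
  · have hf1 := f.2.bounds 1
    have hfn := f.2.le 1
    obtain ⟨l, hU, hD, hUUD, hDDD, hdrop, hl⟩ :=
      ih (n - f.1 1) (by omega) ⟨_, FibSeq.isFibSeq_shift f 1⟩ (t := t - 1) (by omega)
    have hmono : ∀ j, f.1 1 ≤ f.1 (j + 1) := fun j => by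
      have := f.2.growth_of_le (show 1 ≤ j + 1 by omega)
      omega
    have hlj : ∀ j, downsBefore l j = f.1 (j + 1) - f.1 1 := fun j => congrFun hl j
    have hUl : ¬ [U, U, D] <:+: U :: l := by
      rw [List.infix_cons_iff, not_or]
      refine ⟨?_, hUUD⟩
      rintro ⟨l', hl'⟩
      -- If `l` starts with `U`, the next part is 0, so `f` has already reached `n` and no `D` is
      -- left for `l`.
      obtain rfl : U :: D :: l' = l := by simpa using hl'
      have h1 := hlj 1
      have h2 := f.2.2 1
      simp at hD h1 h2
      omega
    have hDl : ¬ [D, D, D] <:+: U :: l := by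
      rw [List.infix_cons_iff, not_or]
      exact ⟨by simp, hDDD⟩
    rcases (by omega : f.1 1 = 1 ∨ f.1 1 = 2) with h1 | h1
    · refine ⟨D :: U :: l, by simp [hU]; omega, by simp [hD]; omega, ?_, ?_, ?_, ?_⟩
      · rw [List.infix_cons_iff, not_or]
        exact ⟨by simp, hUl⟩
      · rw [List.infix_cons_iff, not_or]
        exact ⟨by simp, hDl⟩
      · rintro (_ | _ | i)
        · simp [hU, hD]
          omega
        · simp [hU, hD]
          omega
        · simpa using hdrop i
      · funext j
        rcases j with _ | _ | j
        · simp [f.2.1]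
        · simp [h1]
        · have := hmono (j + 1)
          have := hlj (j + 1)
          simp only [downsBefore_D_cons, downsBefore_U_cons]
          omega
    · refine ⟨D :: D :: U :: l, by simp [hU]; omega, by simp [hD]; omega, ?_, ?_, ?_, ?_⟩
      · rw [List.infix_cons_iff, not_or, List.infix_cons_iff, not_or]
        exact ⟨by simp, by simp, hUl⟩
      · rw [List.infix_cons_iff, not_or, List.infix_cons_iff, not_or]
        exact ⟨by simp, by simp, hDl⟩
      · rintro (_ | _ | _ | i)
        · simp [hU, hD]
          omega
        · simp [hU, hD]
          omega
        · simp [hU, hD]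
          omega
        · simpa using hdrop i
      · funext j
        rcases j with _ | _ | j
        · simp [f.2.1]
        · simp [h1]
        · have := hmono (j + 1)
          have := hlj (j + 1)
          simp only [downsBefore_D_cons, downsBefore_U_cons]
          omega

/-- The sequence of partial sums of the composition of `n` that corresponds to a path. -/
def toFibSeq {n : ℕ} (P : FibDyck 2 n) : FibSeq n :=
  ⟨downsBefore P.path.toList.reverse, by
    refine isFibSeq_downsBefore P.count_U_reverse P.count_D_reverse ?_ ?_ fun i => ?_
    · rw [← List.reverse_infix]
      simpa using P.avoids_DUU
    · rw [← List.reverse_infix]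
      simpa using P.avoids_D_pow
    · rw [List.drop_reverse, List.count_reverse, List.count_reverse]
      exact P.path.count_D_le_count_U _⟩

theorem toFibSeq_le_iff {n : ℕ} (P Q : FibDyck 2 n) : P.toFibSeq ≤ Q.toFibSeq ↔ P ≤ Q :=
  (le_iff_downsBefore P Q).symm

theorem toFibSeq_surjective (n : ℕ) : Function.Surjective (toFibSeq (n := n)) := by
  intro f
  obtain ⟨l, hU, hD, hUUD, hDDD, hdrop, hl⟩ := exists_downsBefore_eq f le_rfl
  refine ⟨⟨⟨l.reverse, by simp [hU, hD], fun i => ?_⟩, ?_, ?_, ?_⟩, Subtype.ext ?_⟩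
  · rw [List.take_reverse, List.count_reverse, List.count_reverse]
    exact hdrop _
  · simpa [DyckWord.semilength] using hU
  · rw [← List.reverse_infix]
    simpa using hUUD
  · rw [← List.reverse_infix]
    simpa using hDDD
  · simpa [toFibSeq] using hl

/-- The poset of paths of semilength `n` that avoid `DUU` and `DDD` is isomorphic to the poset of
the sequences of partial sums of compositions of `n` into parts `1` and `2`. -/
noncomputable def fibSeqIso (n : ℕ) : FibDyck 2 n ≃o FibSeq n :=
  RelIso.ofSurjective (OrderEmbedding.ofMapLEIff toFibSeq toFibSeq_le_iff) (toFibSeq_surjective n)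

end FibDyck

theorem numLinearIntervals_two (n k : ℕ) :
    numLinearIntervals 2 n k = (FibSeq.chainPairs n k).ncard :=
  card_linear_intervals_eq (FibDyck.fibSeqIso n) k

/-! ### Generating functions. -/

/-- The formal power series in two variables `x = X 0`, `y = X 1` in which the coefficient of
`x ^ n * y ^ k` is `a n k`. -/
def bivariateSeries (a : ℕ → ℕ → ℚ) : MvPowerSeries (Fin 2) ℚ :=
  fun m => a (m 0) (m 1)

namespace bivariateSeries

open MvPowerSeries

theorem coeff_eq (a : ℕ → ℕ → ℚ) (m : Fin 2 →₀ ℕ) :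
    coeff m (bivariateSeries a) = a (m 0) (m 1) := rfl

theorem coeff_X_mul_eq (s : Fin 2) (φ : MvPowerSeries (Fin 2) ℚ) (m : Fin 2 →₀ ℕ) :
    coeff m (X s * φ) = if m s = 0 then 0 else coeff (m - Finsupp.single s 1) φ := by
  split_ifs with h
  · rw [X, coeff_monomial_mul, if_neg]
    intro hle
    have := hle s
    simp [h] at this
  · rw [X, coeff_monomial_mul, if_pos, one_mul]
    intro i
    by_cases hi : s = i
    · subst hi
      simp
      omega
    · simp [hi]

theorem X_zero_mul (a : ℕ → ℕ → ℚ) :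
    X 0 * bivariateSeries a = bivariateSeries fun n k => if n = 0 then 0 else a (n - 1) k := by
  ext m
  rw [coeff_X_mul_eq, coeff_eq, coeff_eq]
  simp

theorem X_one_mul (a : ℕ → ℕ → ℚ) :
    X 1 * bivariateSeries a = bivariateSeries fun n k => if k = 0 then 0 else a n (k - 1) := by
  ext m
  rw [coeff_X_mul_eq, coeff_eq, coeff_eq]
  simp

theorem one_eq : (1 : MvPowerSeries (Fin 2) ℚ) =
    bivariateSeries fun n k => if n = 0 ∧ k = 0 then 1 else 0 := by
  classical
  ext m
  rw [coeff_eq, coeff_one]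
  congr 1
  simp [Finsupp.ext_iff, Fin.forall_fin_two]

theorem add_eq (a b : ℕ → ℕ → ℚ) :
    bivariateSeries a + bivariateSeries b = bivariateSeries fun n k => a n k + b n k := rfl

end bivariateSeries

open MvPowerSeries bivariateSeries

/-- The number of compositions of `n` into parts `1` and `2`. -/
noncomputable def FibSeq.count (n : ℕ) : ℚ := Nat.card (FibSeq n)

theorem FibSeq.count_zero : FibSeq.count 0 = 1 := by
  rw [FibSeq.count, FibSeq.card_of_le_one (by norm_num), Nat.cast_one]

theorem FibSeq.count_one : FibSeq.count 1 = 1 := by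
  rw [FibSeq.count, FibSeq.card_of_le_one (by norm_num), Nat.cast_one]

theorem FibSeq.count_add_two (n : ℕ) :
    FibSeq.count (n + 2) = FibSeq.count (n + 1) + FibSeq.count n := by
  simp only [FibSeq.count]
  rw [FibSeq.card_add_two, Nat.cast_add]

/-- The generating function of the compositions into parts `1` and `2`. -/
noncomputable def fibSeries := bivariateSeries fun n k => if k = 0 then FibSeq.count n else 0

/-- The generating function of `FibSeq.onesPairs`. -/
noncomputable def onesSeries := bivariateSeries fun n k =>
  if 1 ≤ k ∧ k + 1 ≤ n then FibSeq.count (n - (k + 2)) else 0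

/-- The generating function of `FibSeq.twosPairs`. -/
noncomputable def twosSeries := bivariateSeries fun n k =>
  if 2 ≤ k ∧ 2 * k ≤ n then FibSeq.count (n - (2 * k + 1)) else 0

theorem fibSeries_eq : fibSeries = 1 + X 0 * fibSeries + X 0 * (X 0 * fibSeries) := by
  rw [fibSeries, one_eq]
  simp only [X_zero_mul, add_eq]
  congr 1
  funext n k
  rcases n with _ | _ | n
  · by_cases hk : k = 0 <;> simp [hk, FibSeq.count_zero]
  · by_cases hk : k = 0 <;> simp [hk, FibSeq.count_zero, FibSeq.count_one]
  · by_cases hk : k = 0 <;> simp [hk, FibSeq.count_add_two]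

/-- Raising `n` and `k` together by one preserves the count, which gives the factor `xy`; the case
`k = 1` starts the recursion, its summand 1 being the truncated case `n = 2`. The nested products
let every multiplication act as an index shift. -/
theorem onesSeries_eq : onesSeries =
    X 0 * (X 1 * onesSeries) + X 0 * (X 0 * (X 1 * (1 + X 0 * fibSeries))) := by
  rw [fibSeries, onesSeries, one_eq]
  simp only [X_zero_mul, X_one_mul, add_eq]
  congr 1
  funext n k
  rcases k with _ | _ | k
  · simp
  · rcases n with _ | _ | _ | n <;> simp [FibSeq.count_zero]
  · rcases n with _ | n
    · simp
    · simp only [show n + 1 - (k + 1 + 1 + 2) = n - (k + 1 + 2) by omega]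
      simp

/-- Raising `k` by one costs 2 in `n`; the recursion starts at `k = 2`, with the truncated case `n =
4`. -/
theorem twosSeries_eq : twosSeries = X 0 * (X 0 * (X 1 * twosSeries)) +
    X 0 * (X 0 * (X 0 * (X 0 * (X 1 * (X 1 * (1 + X 0 * fibSeries)))))) := by
  rw [fibSeries, twosSeries, one_eq]
  simp only [X_zero_mul, X_one_mul, add_eq]
  congr 1
  funext n k
  rcases k with _ | _ | _ | k
  · simp
  · simp
  · rcases n with _ | _ | _ | _ | _ | n <;> simp [FibSeq.count_zero]
  · rcases n with _ | _ | n
    · simp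
    · simp
      omega
    · simp only [show n + 1 + 1 - (2 * (k + 1 + 1 + 1) + 1) = n - (2 * (k + 1 + 1) + 1) by omega,
        show 2 * (k + 1 + 1 + 1) ≤ n + 1 + 1 ↔ 2 * (k + 1 + 1) ≤ n by omega]
      simp

theorem sporadic_eq : bivariateSeries (fun n k =>
      (if n = 4 ∧ k = 4 then 1 else 0) + if n = 4 ∧ k = 3 then 1 else 0) =
    X 0 * (X 0 * (X 0 * (X 0 * (X 1 * (X 1 * (X 1 * (1 + X 1 * 1))))))) := by
  rw [one_eq]
  simp only [X_zero_mul, X_one_mul, add_eq]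
  congr 1
  funext n k
  rcases n with _ | _ | _ | _ | n <;> rcases k with _ | _ | _ | _ | k <;>
    simp [add_comm (if _ then (1 : ℚ) else 0)]

theorem linearIntervalSeries_two_eq : linearIntervalSeries 2 = 1 + X 0 * linearIntervalSeries 2 +
    X 0 * (X 0 * linearIntervalSeries 2) + (onesSeries + twosSeries) +
    X 0 * (X 0 * (X 0 * (X 0 * (X 1 * (X 1 * (X 1 * (1 + X 1 * 1))))))) := by
  have hL : linearIntervalSeries 2 =
    bivariateSeries fun n k => ((FibSeq.chainPairs n k).ncard : ℚ) := by
    ext m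
    change (numLinearIntervals 2 (m 0) (m 1) : ℚ) = _
    rw [numLinearIntervals_two]
    rfl
  rw [← sporadic_eq, hL, onesSeries, twosSeries, one_eq]
  simp only [X_zero_mul, add_eq]
  congr 1
  funext n k
  rcases n with _ | _ | n
  · rw [FibSeq.ncard_chainPairs_of_le_one (by norm_num)]
    by_cases hk : k = 0 <;> simp [hk]
  · rw [FibSeq.ncard_chainPairs_of_le_one (by norm_num)]
    by_cases hk : k = 0 <;> simp [hk, FibSeq.ncard_chainPairs_of_le_one]
    omega
  · rw [FibSeq.ncard_chainPairs_add_two, FibSeq.ncard_irreduciblePairs]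
    simp [FibSeq.count, add_assoc]

theorem mainTheorem6 (x y : MvPowerSeries (Fin 2) ℚ)
    (hx : x = MvPowerSeries.X 0) (hy : y = MvPowerSeries.X 1) :
    linearIntervalSeries 2 =
      (x ^ 4 * y ^ 4 + y ^ 3 * x ^ 4 + 1) * (1 - x - x ^ 2)⁻¹ +
        (x ^ 2 * y * (x ^ 2 - 1) * (x ^ 3 * y ^ 2 - 1)) *
          ((x * y - 1) * (x ^ 2 + x - 1) ^ 2 * (x ^ 2 * y - 1))⁻¹ := by
  have hL := linearIntervalSeries_two_eq
  have hA := onesSeries_eq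
  have hB := twosSeries_eq
  have hF := fibSeries_eq
  have hx0 : constantCoeff x = 0 := by rw [hx, constantCoeff_X]
  rw [← hx, ← hy] at hL
  rw [← hx, ← hy] at hA hB
  rw [← hx] at hF
  set L := linearIntervalSeries 2
  have h1 : (1 - x - x ^ 2) * (1 - x - x ^ 2)⁻¹ = 1 :=
    MvPowerSeries.mul_inv_cancel _ (by simp [hx0])
  have h2 : ((x * y - 1) * (x ^ 2 + x - 1) ^ 2 * (x ^ 2 * y - 1)) *
      ((x * y - 1) * (x ^ 2 + x - 1) ^ 2 * (x ^ 2 * y - 1))⁻¹ = 1 :=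
    MvPowerSeries.mul_inv_cancel _ (by simp [hx0])
  have h3 : (x * y - 1) * (x ^ 2 + x - 1) ^ 2 * (x ^ 2 * y - 1) ≠ 0 := fun h => by
    rw [h, zero_mul] at h2
    exact zero_ne_one h2
  -- From here the inverses are only known through `h1` and `h2`, and the claim is a polynomial
  -- identity modulo the functional equations.
  generalize (1 - x - x ^ 2)⁻¹ = u at *
  generalize ((x * y - 1) * (x ^ 2 + x - 1) ^ 2 * (x ^ 2 * y - 1))⁻¹ = v at *
  have hu : fibSeries = u := by
    linear_combination u * hF - fibSeries * h1
  apply mul_left_cancel₀ h3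
  rw [hu] at hA hB
  linear_combination (x * y - 1) * (x ^ 2 * y - 1) * (1 - x - x ^ 2) * hL -
    (x ^ 2 * y - 1) * (1 - x - x ^ 2) * hA - (x * y - 1) * (1 - x - x ^ 2) * hB -
    ((x ^ 2 * y - 1) * x ^ 3 * y + (x * y - 1) * x ^ 5 * y ^ 2 +
      (x * y - 1) * (x ^ 2 * y - 1) * (1 - x - x ^ 2) * (1 + x ^ 4 * y ^ 3 + x ^ 4 * y ^ 4)) * h1 -
    (x ^ 2 * y * (x ^ 2 - 1) * (x ^ 3 * y ^ 2 - 1)) * h2
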